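/- Call an object of a category connected if it is not initial and is not a coproduct of two non-initial objects, and say that an object has power $\alpha$ (a cardinal) if it is a coproduct of $\alpha$ connected objects. A (locally small) category $\mathcal K$ is said to have width $w(\mathcal K)$ if it has coproducts, every object is a coproduct of (a set of) connected objects, and $w(\mathcal K)$ is the smallest cardinal such that (a) $\mathcal K$ has at most $w(\mathcal K)$ connected objects up to isomorphism, and (b) for every cardinal $\alpha\ge w(\mathcal K)$ there are at most $\alpha$ morphisms from a connected object to an object of power $\alpha$. For an infinite cardinal $\lambda>w(\mathcal K)$ let $\mathcal K_{\le\lambda}$ be the full subcategory of $\mathcal K$ on the objects that have power $\alpha$ for some $\alpha\le\lambda$. Theorem. Assume the Generalized Continuum Hypothesis ($2^{\mu}=\mu^{+}$ for every infinite cardinal $\mu$). Let $\mathcal K$ be a cocomplete and cowellpowered category that has width $w(\mathcal K)$. Then for every uncountable regular cardinal $\lambda>w(\mathcal K)$ the category $\mathcal K_{\le\lambda}$ is algebraically cocomplete, i.e. every endofunctor $F$ of $\mathcal K_{\le\lambda}$ has a terminal coalgebra. -/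

import Mathlib

open CategoryTheory CategoryTheory.Limits

universe v u

/-- The Generalized Continuum Hypothesis: for every infinite cardinal `c` the next larger
cardinal is `2 ^ c`. -/
def GCH : Prop :=
  ∀ c : Cardinal.{v}, Cardinal.aleph0 ≤ c → Order.succ c = 2 ^ c

section Power

variable {C : Type u} [Category.{v} C]

/-- An object is connected if it is not initial and is not a coproduct of two non-initial
objects: in every coproduct decomposition `X = A + B` one of the summands is initial. -/
def IsConnectedObject (X : C) : Prop :=
  IsEmpty (IsInitial X) ∧
    ∀ (A B : C) (f : A ⟶ X) (g : B ⟶ X), Nonempty (IsColimit (BinaryCofan.mk f g)) →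
      Nonempty (IsInitial A) ∨ Nonempty (IsInitial B)

/-- `X` has power `α` if it is a coproduct of `α` connected objects. -/
def HasPower (X : C) (α : Cardinal.{v}) : Prop :=
  ∃ (ι : Type v) (Y : ι → C) (inj : ∀ i, Y i ⟶ X),
    Cardinal.mk ι = α ∧ (∀ i, IsConnectedObject (Y i)) ∧
      Nonempty (IsColimit (Cofan.mk X inj))

end Power

section Width

variable (C : Type u) [Category.{v} C]

/-- The set of isomorphism classes of connected objects of `C`. -/
def connectedClasses : Set (Quotient (isIsomorphicSetoid C)) :=
  {c | ∃ X : C, IsConnectedObject X ∧ Quotient.mk (isIsomorphicSetoid C) X = c}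

/-- The two bounds in the definition of width: there are at most `w` connected objects up to
isomorphism, and for every `α ≥ w` there are at most `α` morphisms from a connected object to
an object of power `α`. -/
def IsWidthBound (w : Cardinal.{v}) : Prop :=
  Cardinal.lift.{v} (Cardinal.mk (connectedClasses C)) ≤ Cardinal.lift.{u} w ∧
    ∀ α : Cardinal.{v}, w ≤ α → ∀ B X : C, IsConnectedObject B → HasPower X α →
      Cardinal.mk (B ⟶ X) ≤ α

/-- `C` has width `w`: it has (small) coproducts, every object is a coproduct of connected
objects, and `w` is the smallest cardinal satisfying the two bounds. -/
def HasWidth (w : Cardinal.{v}) : Prop :=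
  HasCoproducts.{v} C ∧ (∀ X : C, ∃ α : Cardinal.{v}, HasPower X α) ∧
    IsLeast {k : Cardinal.{v} | IsWidthBound C k} w

/-- The objects of power at most `k`; the corresponding full subcategory is
`(powerLE C k).FullSubcategory`. -/
def powerLE (k : Cardinal.{v}) : ObjectProperty C :=
  fun X => ∃ α : Cardinal.{v}, α ≤ k ∧ HasPower X α

/-- Cowellpowered: every object has only a (small) set of quotients, that is, of epimorphisms
out of it up to isomorphism; these are the subobjects in the opposite category. -/
def IsCowellPowered : Prop :=
  WellPowered.{v} Cᵒᵖ

/-- Algebraically cocomplete: every endofunctor has a terminal coalgebra. -/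
def AlgebraicallyCocomplete : Prop :=
  ∀ F : C ⥤ C, HasTerminal (Endofunctor.Coalgebra F)

end Width

/-! Write `k` for the regular cardinal. The terminal coalgebra is the colimit of all small
coalgebras, those carried by a coproduct of fewer than `k` connected objects.

The heart is `exists_small_support`. If `X` is a coproduct of at most `k` connected objects,
selfmaps of the index set that preserve the type of each component act on `X`, hence on the at most
`k` morphisms `B ⟶ G X`. More than `k` almost disjoint injections `s` act, so two of them, `s f` and
`s g`, agree on a given morphism `b`. With `r f` a retraction of `s f`, the composite of `s g` and
`r f` fixes `b` and has small range, so `b` depends on fewer than `k` components.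

Closing up under supports, every coalgebra is covered by a directed family of small split
subcoalgebras (`exists_small_subcoalgebra`). Hence a compatible family of homomorphisms from the
small coalgebras extends uniquely to all coalgebras. Under GCH there are at most `k` small
coalgebras up to isomorphism, and their colimit exists because quotients of objects of power at most
`k` again have power at most `k` (`powerLE_of_epi`). -/

namespace AlgebraicCocompleteness

/-! ### Cardinal arithmetic under GCH and almost disjoint families. -/

section SetTheory

open Cardinal

theorem mk_Iio_ord_toType_lt_self {k : Cardinal.{v}} (i : k.ord.ToType) : #(Set.Iio i) < k := by
  simpa using mk_Iio_lt i (by simp)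

/-- Under GCH, `2 ^ c ≤ k` for all `c` below an infinite cardinal `k`. -/
theorem two_power_le_of_lt (gch : GCH.{v}) {c k : Cardinal.{v}} (hk : ℵ₀ ≤ k) (hc : c < k) :
    (2 : Cardinal.{v}) ^ c ≤ k := by
  rcases lt_or_ge c ℵ₀ with h | h
  · exact (power_lt_aleph0 (natCast_lt_aleph0) h).le.trans hk
  · rw [← gch c h]
    exact Order.succ_le_of_lt hc

/-- Under GCH, `k ^ c ≤ k` for `c` below a regular cardinal `k`. -/
theorem power_le_self_of_lt (gch : GCH.{v}) {c k : Cardinal.{v}} (hk : k.IsRegular)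
    (hc : c < k) : k ^ c ≤ k := by
  -- By regularity every function from `c` to `k` is bounded, so it suffices to count the functions
  -- into each proper initial segment.
  have hbdd : ∀ f : c.out → k.ord.ToType, ∃ i, ∀ x, f x < i := by
    intro f
    by_contra! h
    have hlt : #(⋃ x, Set.Iic (f x)) < k := by
      rw [card_iUnion_lt_iff_forall_of_isRegular hk (by simpa using hc)]
      intro x
      rw [← Set.Iio_insert]
      refine (mk_insert_le).trans_lt ?_
      exact add_lt_of_lt hk.aleph0_le (mk_Iio_ord_toType_lt_self _) (one_lt_aleph0.trans_le hk.aleph0_le)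
    have huniv : (⋃ x, Set.Iic (f x)) = Set.univ := by
      ext i
      obtain ⟨x, hx⟩ := h i
      simpa using ⟨x, hx⟩
    rw [huniv] at hlt
    simp at hlt
  choose b hb using hbdd
  have hinj : Function.Injective
      (fun f : c.out → k.ord.ToType => (⟨b f, fun x => ⟨f x, hb f x⟩⟩ :
        Σ i : k.ord.ToType, c.out → Set.Iio i)) := by
    intro f g hfg
    have key : ∀ (i j : k.ord.ToType) (p : c.out → Set.Iio i) (q : c.out → Set.Iio j),
        (⟨i, p⟩ : Σ i : k.ord.ToType, c.out → Set.Iio i) = ⟨j, q⟩ →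
          ∀ x, (p x : k.ord.ToType) = q x := by
      rintro i j p q h x
      cases h
      rfl
    funext x
    exact key _ _ _ _ hfg x
  have h1 := mk_le_of_injective hinj
  have h2 : #(c.out → k.ord.ToType) = k ^ c := by simp
  rw [h2, mk_sigma] at h1
  refine h1.trans ((sum_le_sum _ (fun _ => k) fun i => ?_).trans ?_)
  · have hi := mk_Iio_ord_toType_lt_self i
    calc #(c.out → Set.Iio i) = #(Set.Iio i) ^ c := by simp
      _ ≤ (2 ^ #(Set.Iio i)) ^ c := power_le_power_right (cantor _).le
      _ = 2 ^ (#(Set.Iio i) * c) := by rw [power_mul]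
      _ ≤ k := two_power_le_of_lt gch hk.aleph0_le (mul_lt_of_lt hk.aleph0_le hi hc)
  · simp [mul_eq_self hk.aleph0_le]

/-- An almost disjoint family of `2 ^ k` injections of `k` into itself. -/
theorem exists_almost_disjoint_injections (gch : GCH.{v}) {k : Cardinal.{v}} (hk : ℵ₀ ≤ k)
    (L : Type v) (hL : #L = k) :
    ∃ (Φ : Type v) (s : Φ → L → L), k < #Φ ∧ (∀ f, Function.Injective (s f)) ∧
      ∀ f g, f ≠ g → #↥(Set.range (s f) ∩ Set.range (s g)) < k := by
  obtain ⟨e⟩ : Nonempty (L ≃ k.ord.ToType) := by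
    rw [← Cardinal.eq, hL]; simp
  -- The binary tree of height `k` has at most `k` nodes. A branch `f` yields the injection sending
  -- a level to the code of the node of `f` there; distinct branches share nodes only up to the
  -- first place where they differ.
  have hcode : #(Σ i : k.ord.ToType, Set.Iio i → Bool) ≤ #L := by
    rw [mk_sigma, hL]
    refine (sum_le_sum _ (fun _ => k) fun i => ?_).trans ?_
    · have hi := mk_Iio_ord_toType_lt_self i
      simpa using two_power_le_of_lt gch hk hi
    · simp [mul_eq_self hk]
  obtain ⟨code⟩ := hcode
  refine ⟨k.ord.ToType → Bool, fun f x => code ⟨e x, fun y => f y⟩, ?_, ?_, ?_⟩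
  · simpa using cantor k
  · intro f x y hxy
    have := code.injective hxy
    exact e.injective (congrArg Sigma.fst this)
  · intro f g hfg
    obtain ⟨j, hj⟩ := Function.ne_iff.mp hfg
    have hsub : Set.range (fun x => code ⟨e x, fun y => f y⟩) ∩
        Set.range (fun x => code ⟨e x, fun y => g y⟩) ⊆
        (fun i : k.ord.ToType => code ⟨i, fun y => f y⟩) '' Set.Iic j := by
      rintro _ ⟨⟨x, rfl⟩, ⟨y, hy⟩⟩
      refine ⟨e x, ?_, rfl⟩
      have h := code.injective hy
      have key : ∀ (i i' : k.ord.ToType) , (⟨i, fun y => g y⟩ :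
          Σ i : k.ord.ToType, Set.Iio i → Bool) = ⟨i', fun y => f y⟩ →
            ∀ z < i', g z = f z := by
        intro i i' hii z hz
        obtain rfl : i = i' := congrArg Sigma.fst hii
        have := eq_of_heq (Sigma.mk.inj hii).2
        exact congrFun this ⟨z, hz⟩
      by_contra hlt
      exact hj (key _ _ h j (not_le.mp hlt)).symm
    refine (mk_le_mk_of_subset hsub).trans_lt (mk_image_le.trans_lt ?_)
    rw [← Set.Iio_insert]
    exact (mk_insert_le).trans_lt
      (add_lt_of_lt hk (mk_Iio_ord_toType_lt_self _) (one_lt_aleph0.trans_le hk))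

/-- A family of pairs of selfmaps of a set of size at most `k`, each split by its retraction,
such that mixed composites have range smaller than `k`. -/
theorem exists_selfmaps_small_range (gch : GCH.{v}) {k : Cardinal.{v}} (hk : ℵ₀ ≤ k)
    {T : Type v} (S : T → Type v) (hS : ∀ t, #(S t) ≤ k) :
    ∃ (Φ : Type v) (s r : Φ → ∀ t, S t → S t), k < #Φ ∧ (∀ f t x, r f t (s f t x) = x) ∧
      ∀ f g, f ≠ g → ∀ t, #(Set.range fun x => r f t (s g t x)) < k := by
  obtain ⟨Φ, s, hΦ, hinj, hdisj⟩ :=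
    exists_almost_disjoint_injections gch hk k.out (by simp)
  have main : ∀ t, ∃ (s r : Φ → S t → S t), (∀ f x, r f (s f x) = x) ∧
      ∀ f g, f ≠ g → #(Set.range fun x => r f (s g x)) < k := by
    intro t
    rcases (hS t).lt_or_eq with h | h
    · exact ⟨fun _ x => x, fun _ x => x, fun _ _ => rfl, fun f g _ => mk_range_le.trans_lt h⟩
    · obtain ⟨e⟩ : Nonempty (S t ≃ k.out) := by rw [← Cardinal.eq, h]; simp
      have : Nonempty k.out := by
        rw [← mk_ne_zero_iff, mk_out]
        exact (aleph0_pos.trans_le hk).ne'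
      refine ⟨fun f x => e.symm (s f (e x)), fun f x => e.symm (Function.invFun (s f) (e x)),
        fun f x => ?_, fun f g hfg => ?_⟩
      · simp [Function.leftInverse_invFun (hinj f) (e x)]
      -- Off the range of `s f`, `Function.invFun` takes one default value, which accounts for the
      -- inserted point.
      · have hsub : (Set.range fun x => e.symm (Function.invFun (s f) (e (e.symm (s g (e x)))))) ⊆
            insert (e.symm (Classical.arbitrary k.out))
              ((fun y => e.symm (Function.invFun (s f) y)) ''
                (Set.range (s f) ∩ Set.range (s g))) := by
          rintro _ ⟨x, rfl⟩
          simp only [Equiv.apply_symm_apply]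
          by_cases hx : ∃ y, s f y = s g (e x)
          · exact Or.inr ⟨_, ⟨hx, ⟨_, rfl⟩⟩, rfl⟩
          · left
            rw [Function.invFun_neg hx]
        refine (mk_le_mk_of_subset hsub).trans_lt (mk_insert_le.trans_lt ?_)
        exact add_lt_of_lt hk (mk_image_le.trans_lt (hdisj f g hfg))
          (one_lt_aleph0.trans_le hk)
  choose s r h1 h2 using main
  exact ⟨Φ, fun f t => s t f, fun f t => r t f, hΦ, fun f t => h1 t f,
    fun f g hfg t => h2 t f g hfg⟩

/-- If the selfmaps of a `T`-indexed family of sets act on a set `H` of size at most `k`, then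
every element of `H` is fixed by a selfmap of small range. -/
theorem exists_fixing_selfmap_small_range (gch : GCH.{v}) {k : Cardinal.{v}} (hk : k.IsRegular)
    {T : Type v} (hT : #T < k) (S : T → Type v) (hS : ∀ t, #(S t) ≤ k) (H : Type v)
    (hH : #H ≤ k) (act : (∀ t, S t → S t) → H → H) (act_id : ∀ b, act (fun _ x => x) b = b)
    (act_comp : ∀ g h b, act (fun t x => g t (h t x)) b = act g (act h b)) (b : H) :
    ∃ g : ∀ t, S t → S t, act g b = b ∧ #(Set.range fun p : Σ t, S t =>
      (⟨p.1, g p.1 p.2⟩ : Σ t, S t)) < k := by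
  obtain ⟨Φ, s, r, hΦ, hrs, hsmall⟩ := exists_selfmaps_small_range gch hk.aleph0_le S hS
  -- Pigeonhole: more than `k` indices, at most `k` elements of `H`.
  obtain ⟨f, g, hfg, hne⟩ : ∃ f g, act (s f) b = act (s g) b ∧ f ≠ g := by
    have : ¬ Function.Injective fun f => act (s f) b := fun h =>
      (hΦ.trans_le ((mk_le_of_injective h).trans hH)).false
    simpa [Function.Injective] using this
  refine ⟨fun t x => r f t (s g t x), ?_, ?_⟩
  · rw [act_comp, ← hfg, ← act_comp]
    simp only [hrs, act_id]
  · have hsub : (Set.range fun p : Σ t, S t => (⟨p.1, r f p.1 (s g p.1 p.2)⟩ : Σ t, S t)) ⊆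
        ⋃ t, Sigma.mk t '' (Set.range fun x => r f t (s g t x)) := by
      rintro _ ⟨⟨t, x⟩, rfl⟩
      exact Set.mem_iUnion.2 ⟨t, _, ⟨x, rfl⟩, rfl⟩
    refine (mk_le_mk_of_subset hsub).trans_lt ?_
    rw [card_iUnion_lt_iff_forall_of_isRegular hk hT]
    exact fun t => mk_image_le.trans_lt (hsmall f g hne t)

theorem mk_union_lt {k : Cardinal.{v}} (hk : ℵ₀ ≤ k) {I : Type v} {A B : Set I} (hA : #A < k)
    (hB : #B < k) : #↥(A ∪ B) < k :=
  (mk_union_le A B).trans_lt (add_lt_of_lt hk hA hB)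

/-- Every small subset is contained in a small subset closed under a small-set-valued
operation. -/
theorem exists_small_closed {k : Cardinal.{v}} (hk : k.IsRegular) (hunc : ℵ₀ < k) {I : Type v}
    (N : I → Set I) (hN : ∀ i, #(N i) < k) (R₀ : Set I) (hR₀ : #R₀ < k) :
    ∃ R : Set I, R₀ ⊆ R ∧ #R < k ∧ ∀ i ∈ R, N i ⊆ R := by
  -- Countably many rounds suffice; their union is still small because `k` is regular and
  -- uncountable.
  let Q : ℕ → Set I := fun n => Nat.rec R₀ (fun _ A => ⋃ i ∈ A, N i) n
  have hQ : ∀ n, #↥(Q n) < k := by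
    intro n
    induction n with
    | zero => exact hR₀
    | succ n ih =>
      change #↥(⋃ i ∈ Q n, N i) < k
      rw [card_biUnion_lt_iff_forall_of_isRegular hk ih]
      exact fun i _ => hN i
  refine ⟨⋃ n : ULift.{v} ℕ, Q n.down, ?_, ?_, ?_⟩
  · exact Set.subset_iUnion (fun n : ULift.{v} ℕ => Q n.down) ⟨0⟩
  · rw [card_iUnion_lt_iff_forall_of_isRegular hk (by simpa using hunc)]
    exact fun n => hQ _
  · intro i hi x hx
    obtain ⟨n, hn⟩ := Set.mem_iUnion.1 hi
    exact Set.mem_iUnion.2 ⟨⟨n.down + 1⟩, Set.mem_biUnion hn hx⟩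

end SetTheory

/-! ### Small supports of morphisms into the image of a coproduct. -/

section Factorization

open Cardinal

variable {D : Type u} [Category.{v} D]

/-- The morphism out of a coproduct with given components. -/
noncomputable def cofanDesc {J : Type v} {Y : J → D} {X : D} {inj : ∀ j, Y j ⟶ X}
    (hX : IsColimit (Cofan.mk X inj)) {Z : D} (f : ∀ j, Y j ⟶ Z) : X ⟶ Z :=
  Cofan.IsColimit.desc hX f

theorem inj_cofanDesc {J : Type v} {Y : J → D} {X : D} {inj : ∀ j, Y j ⟶ X}
    (hX : IsColimit (Cofan.mk X inj)) {Z : D} (f : ∀ j, Y j ⟶ Z) (j : J) :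
    inj j ≫ cofanDesc hX f = f j :=
  Cofan.IsColimit.fac hX f j

theorem cofan_hom_ext {J : Type v} {Y : J → D} {X : D} {inj : ∀ j, Y j ⟶ X}
    (hX : IsColimit (Cofan.mk X inj)) {Z : D} {f g : X ⟶ Z}
    (h : ∀ j, inj j ≫ f = inj j ≫ g) : f = g :=
  Cofan.IsColimit.hom_ext hX f g h

/-- Let `X` be a coproduct of at most `k` objects of fewer than `k` types. If there are at most
`k` morphisms from `B` to `G X`, then each of them only depends on fewer than `k` components
of `X`. -/
theorem exists_small_support (gch : GCH.{v}) {k : Cardinal.{v}} (hk : k.IsRegular)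
    {T : Type v} (hT : #T < k) (Cn : T → D) {J : Type v} (hJ : #J ≤ k) (τ : J → T) {X : D}
    (inj : ∀ j, Cn (τ j) ⟶ X) (hX : IsColimit (Cofan.mk X inj)) (G : D ⥤ D) {B : D}
    (hB : #(B ⟶ G.obj X) ≤ k) (b : B ⟶ G.obj X) :
    ∃ R : Set J, #R < k ∧ ∀ (Z : D) (m : Z ⟶ X),
      (∀ j ∈ R, ∃ z : Cn (τ j) ⟶ Z, z ≫ m = inj j) → ∃ b' : B ⟶ G.obj Z, b' ≫ G.map m = b := by
  -- `S t` indexes the components of type `t`; a selfmap of each `S t` moves components of `X` among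
  -- equal ones, giving the endomorphism `push g`.
  let S : T → Type v := fun t => {j // τ j = t}
  let inj' : ∀ t, S t → (Cn t ⟶ X) := fun t s => eqToHom (congrArg Cn s.2.symm) ≫ inj s.1
  let push : (∀ t, S t → S t) → (X ⟶ X) := fun g =>
    cofanDesc hX fun j => inj' (τ j) (g (τ j) ⟨j, rfl⟩)
  have inj_push : ∀ g j, inj j ≫ push g = inj' (τ j) (g (τ j) ⟨j, rfl⟩) :=
    fun g j => inj_cofanDesc hX _ j
  have inj'_push : ∀ g t s, inj' t s ≫ push g = inj' t (g t s) := by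
    rintro g t ⟨j, rfl⟩
    simp only [inj', eqToHom_refl, Category.id_comp]
    rw [inj_push]
  have push_id : push (fun _ x => x) = 𝟙 X := by
    refine cofan_hom_ext hX fun j => ?_
    rw [inj_push (fun _ x => x) j]
    simp [inj']
  have push_comp : ∀ g h, push (fun t x => g t (h t x)) = push h ≫ push g := by
    intro g h
    refine cofan_hom_ext hX fun j => ?_
    rw [inj_push (fun t x => g t (h t x)) j, ← Category.assoc, inj_push, inj'_push]
  obtain ⟨g, hg, hsmall⟩ := exists_fixing_selfmap_small_range gch hk hT S
    (fun t => (mk_subtype_le _).trans hJ) (B ⟶ G.obj X) hB (fun g b => b ≫ G.map (push g))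
    (fun b => by rw [push_id, G.map_id, Category.comp_id]) (fun g h b => by rw [push_comp, G.map_comp, Category.assoc]) b
  refine ⟨(fun p : Σ t, S t => p.2.1) '' (Set.range fun p : Σ t, S t => ⟨p.1, g p.1 p.2⟩),
    mk_image_le.trans_lt hsmall, fun Z m hm => ?_⟩
  -- `push g` fixes `b` and only hits components in `R`, so it factors through `m`, and `b` does so
  -- after applying `G`.
  have hz : ∀ j, ∃ z : Cn (τ j) ⟶ Z, z ≫ m = inj j ≫ push g := by
    intro j
    obtain ⟨z, hz⟩ := hm (g (τ j) ⟨j, rfl⟩).1 ⟨_, ⟨⟨τ j, ⟨j, rfl⟩⟩, rfl⟩, rfl⟩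
    refine ⟨eqToHom (congrArg Cn (g (τ j) ⟨j, rfl⟩).2.symm) ≫ z, ?_⟩
    rw [inj_push, Category.assoc, hz]
  choose z hz using hz
  refine ⟨b ≫ G.map (cofanDesc hX z), ?_⟩
  rw [Category.assoc, ← G.map_comp]
  have : cofanDesc hX z ≫ m = push g := by
    refine cofan_hom_ext hX fun j => ?_
    rw [← Category.assoc, inj_cofanDesc]
    exact hz j
  rw [this]
  exact hg

/-- A subcoproduct inclusion splits if every component maps to one of the subcoproduct. -/
theorem exists_retraction_of_subcoproduct {J : Type v} {Y : J → D} {X : D}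
    (inj : ∀ j, Y j ⟶ X) (hX : IsColimit (Cofan.mk X inj)) (R : Set J) {X' : D}
    (inj' : ∀ j : R, Y j ⟶ X') (hR : ∀ j, ∃ i : R, Nonempty (Y j ⟶ Y i)) :
    ∃ r : X ⟶ X', ∀ j : R, inj j ≫ r = inj' j := by
  classical
  choose i f using hR
  refine ⟨cofanDesc hX fun j =>
    if h : j ∈ R then inj' ⟨j, h⟩ else (f j).some ≫ inj' (i j), fun j => ?_⟩
  refine (inj_cofanDesc hX _ j.1).trans ?_
  simp

/-- A set of fewer than `k` indices meeting all nonempty fibres of a map to a set of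
size less than `k`. -/
theorem exists_small_representatives {k : Cardinal.{v}} {T J : Type v} (hT : #T < k)
    (τ : J → T) : ∃ R : Set J, #R < k ∧ ∀ j, ∃ i : R, τ i = τ j := by
  refine ⟨Set.range fun t : Set.range τ => t.2.choose, ?_, fun j =>
    ⟨⟨_, ⟨⟨τ j, j, rfl⟩, rfl⟩⟩, ?_⟩⟩
  · exact mk_range_le.trans_lt ((mk_subtype_le _).trans_lt hT)
  · exact (⟨j, rfl⟩ : ∃ i, τ i = τ j).choose_spec

/-- `X` is a coproduct of fewer than `k` objects of the family `Cn`. -/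
def IsSmallCoproduct {T : Type v} (Cn : T → D) (k : Cardinal.{v}) (X : D) : Prop :=
  ∃ (J : Type v) (τ : J → T) (inj : ∀ j, Cn (τ j) ⟶ X),
    #J < k ∧ Nonempty (IsColimit (Cofan.mk X inj))

/-- A category whose objects are coproducts of at most `k` objects from a family of fewer than
`k` objects, with few morphisms out of these, and with colimits of size at most `k`. -/
structure IsGeneratedBy {T : Type v} (Cn : T → D) (k : Cardinal.{v}) : Prop where
  card_lt : #T < k
  exists_coproduct : ∀ X : D, ∃ (J : Type v) (τ : J → T) (inj : ∀ j, Cn (τ j) ⟶ X),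
    #J ≤ k ∧ Nonempty (IsColimit (Cofan.mk X inj))
  card_hom_le : ∀ t X, #(Cn t ⟶ X) ≤ k
  hasColimits : ∀ (J : Type v) [SmallCategory J], #J ≤ k → HasColimitsOfShape J D

theorem IsGeneratedBy.hasCoproduct {T : Type v} {Cn : T → D} {k : Cardinal.{v}}
    (hD : IsGeneratedBy Cn k) {J : Type v} (hJ : #J ≤ k) (Y : J → D) : HasCoproduct Y := by
  have := hD.hasColimits (Discrete J)
    (by rwa [Cardinal.mk_congr discreteEquiv])
  exact inferInstanceAs (HasColimit (Discrete.functor Y))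

end Factorization

/-! ### Covering a coalgebra by small split subcoalgebras. -/

section Covering

open Cardinal Endofunctor

variable {D : Type u} [Category.{v} D] {T : Type v} {Cn : T → D} {k : Cardinal.{v}}

/-- Fewer than `k` morphisms from generators into a coalgebra factor through a common
subcoalgebra that splits off as an object and is a coproduct of fewer than `k` of the
components of the given coalgebra. -/
theorem exists_small_subcoalgebra (gch : GCH.{v}) (hk : k.IsRegular) (hunc : ℵ₀ < k)
    (hD : IsGeneratedBy Cn k) (F : D ⥤ D) (A : Coalgebra F) {J : Type v} (hJ : #J ≤ k)
    (τ : J → T) (inj : ∀ j, Cn (τ j) ⟶ A.V) (hA : IsColimit (Cofan.mk A.V inj))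
    {I : Type v} (hI : #I < k) (σ : I → T) (b : ∀ i, Cn (σ i) ⟶ A.V) :
    ∃ (Q : Coalgebra F) (q : Q ⟶ A), IsSmallCoproduct Cn k Q.V ∧ IsSplitMono q.f ∧
      (∀ i, ∃ b' : Cn (σ i) ⟶ Q.V, b' ≫ q.f = b i) ∧
      ∀ (Z : D) (h h' : Q.V ⟶ Z), (∀ j (y : Cn (τ j) ⟶ Q.V), y ≫ q.f = inj j →
        y ≫ h = y ≫ h') → h = h' := by
  have supp : ∀ (G : D ⥤ D) (t : T) (b : Cn t ⟶ G.obj A.V), ∃ R : Set J, #R < k ∧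
      ∀ (Z : D) (m : Z ⟶ A.V), (∀ j ∈ R, ∃ z : Cn (τ j) ⟶ Z, z ≫ m = inj j) →
        ∃ b' : Cn t ⟶ G.obj Z, b' ≫ G.map m = b := fun G t b =>
    exists_small_support gch hk hD.card_lt Cn hJ τ inj hA G (hD.card_hom_le t _) b
  -- `N j` supports the structure map on component `j`, and `M i` supports `b i`. A set closed under
  -- `N` carries a subcoalgebra; including the representatives `R₁` of all occurring types makes its
  -- inclusion split.
  choose N hN hNfac using fun j => supp F (τ j) (inj j ≫ A.str)
  choose M hM hMfac using fun i => supp (𝟭 D) (σ i) (b i)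
  obtain ⟨R₁, hR₁, hrep⟩ := exists_small_representatives hD.card_lt τ
  obtain ⟨R, hR₀, hR, hclosed⟩ := exists_small_closed hk hunc N hN (R₁ ∪ ⋃ i, M i)
    (mk_union_lt hk.aleph0_le hR₁ (by rwa [card_iUnion_lt_iff_forall_of_isRegular hk hI]))
  have hcop := hD.hasCoproduct hR.le fun j : R => Cn (τ j)
  let ι : ∀ j : R, Cn (τ j) ⟶ ∐ fun j : R => Cn (τ j) := Sigma.ι fun j : R => Cn (τ j)
  let m : (∐ fun j : R => Cn (τ j)) ⟶ A.V := Sigma.desc fun j => inj j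
  have ι_m : ∀ j, ι j ≫ m = inj j := fun j => Sigma.ι_desc _ _
  obtain ⟨r, hr⟩ := exists_retraction_of_subcoproduct inj hA R ι fun j => by
    obtain ⟨i, hi⟩ := hrep j
    exact ⟨⟨i, hR₀ (Or.inl i.2)⟩, ⟨eqToHom (congrArg Cn hi.symm)⟩⟩
  have m_r : m ≫ r = 𝟙 _ := Sigma.hom_ext _ _ fun j => by
    rw [← Category.assoc]
    change (ι j ≫ m) ≫ r = ι j ≫ _
    rw [ι_m, hr, Category.comp_id]
  have hstr : ∀ j : R, ∃ c : Cn (τ j) ⟶ F.obj (∐ fun j : R => Cn (τ j)),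
      c ≫ F.map m = inj j ≫ A.str := fun j =>
    hNfac j.1 _ m fun i hi => ⟨ι ⟨i, hclosed j j.2 hi⟩, ι_m _⟩
  choose c hc using hstr
  refine ⟨⟨∐ fun j : R => Cn (τ j), Sigma.desc c⟩, ⟨m, Sigma.hom_ext _ _ fun j => ?_⟩, ?_, ?_, ?_,
    ?_⟩
  · rw [← Category.assoc, Sigma.ι_desc, hc, ← Category.assoc]
    exact congrArg (· ≫ A.str) (ι_m j).symm
  · exact ⟨R, fun j => τ j, ι, hR, ⟨coproductIsCoproduct _⟩⟩
  · exact ⟨⟨⟨r, m_r⟩⟩⟩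
  · intro i
    obtain ⟨b', hb'⟩ := hMfac i _ m fun j hj =>
      ⟨ι ⟨j, hR₀ (Or.inr (Set.mem_iUnion.2 ⟨i, hj⟩))⟩, ι_m _⟩
    exact ⟨b', hb'⟩
  · intro Z h h' H
    exact Sigma.hom_ext _ _ fun j => H j (ι j) (ι_m j)

/-- Coalgebras carried by a coproduct of fewer than `k` generators. -/
def smallCoalgebra (Cn : T → D) (k : Cardinal.{v}) (F : D ⥤ D) : ObjectProperty (Coalgebra F) :=
  fun Q => IsSmallCoproduct Cn k Q.V

/-- Every homomorphism from a small coalgebra factors through a split subcoalgebra as soon as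
its components do. -/
theorem exists_factor_of_isSplitMono {F : D ⥤ D} {Q P A : Coalgebra F} (q : Q ⟶ A)
    [IsSplitMono q.f] {I : Type v} {σ : I → T} {inj : ∀ i, Cn (σ i) ⟶ P.V}
    (hP : IsColimit (Cofan.mk P.V inj)) (s : P ⟶ A)
    (h : ∀ i, ∃ y : Cn (σ i) ⟶ Q.V, y ≫ q.f = inj i ≫ s.f) : ∃ u : P ⟶ Q, u ≫ q = s := by
  choose y hy using h
  have hu : cofanDesc hP y ≫ q.f = s.f :=
    cofan_hom_ext hP fun i => by
      rw [← Category.assoc, inj_cofanDesc]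
      exact hy i
  refine ⟨⟨cofanDesc hP y, ?_⟩, Coalgebra.ext hu⟩
  -- `F` preserves the split monomorphism `q.f`, so compatibility with the structure maps may be
  -- tested after `F.map q.f`.
  rw [← cancel_mono (F.map q.f), Category.assoc, ← F.map_comp, hu, Category.assoc, q.h, s.h,
    ← Category.assoc, hu]

/-- Each component of `A` factors through a small subcoalgebra. This gives the uniqueness half of
terminality. -/
theorem coalgebra_hom_ext_of_small (gch : GCH.{v}) (hk : k.IsRegular) (hunc : ℵ₀ < k)
    (hD : IsGeneratedBy Cn k) {F : D ⥤ D} {A Z : Coalgebra F} (h h' : A ⟶ Z)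
    (H : ∀ Q, smallCoalgebra Cn k F Q → ∀ s : Q ⟶ A, s ≫ h = s ≫ h') : h = h' := by
  obtain ⟨J, τ, inj, hJ, ⟨hA⟩⟩ := hD.exists_coproduct A.V
  refine Coalgebra.ext (cofan_hom_ext hA fun j => ?_)
  obtain ⟨Q, q, hQ, -, hfac, -⟩ := exists_small_subcoalgebra gch hk hunc hD F A hJ τ inj hA
    (I := PUnit) (by simpa using one_lt_aleph0.trans hunc) (fun _ => τ j) (fun _ => inj j)
  obtain ⟨y, hy⟩ := hfac ⟨⟩
  rw [← hy, Category.assoc, Category.assoc]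
  exact congrArg (fun f => y ≫ Coalgebra.Hom.f f) (H Q hQ q)

/-- A natural family of homomorphisms from the small coalgebras to `Z` extends to every
coalgebra. -/
theorem exists_coalgebra_hom_of_small (gch : GCH.{v}) (hk : k.IsRegular) (hunc : ℵ₀ < k)
    (hD : IsGeneratedBy Cn k) {F : D ⥤ D} {Z : Coalgebra F}
    (c : ∀ Q, smallCoalgebra Cn k F Q → (Q ⟶ Z))
    (hc : ∀ P Q hP hQ (u : P ⟶ Q), u ≫ c Q hQ = c P hP) (A : Coalgebra F) :
    ∃ h : A ⟶ Z, ∀ Q hQ (s : Q ⟶ A), s ≫ h = c Q hQ := by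
  obtain ⟨J, τ, inj, hJ, ⟨hA⟩⟩ := hD.exists_coproduct A.V
  have cov := fun (I : Type v) (hI : #I < k) (σ : I → T) (b : ∀ i, Cn (σ i) ⟶ A.V) =>
    exists_small_subcoalgebra gch hk hunc hD F A hJ τ inj hA hI σ b
  have single : ∀ j, ∃ (Q : Coalgebra F) (q : Q ⟶ A) (_ : smallCoalgebra Cn k F Q)
      (x : Cn (τ j) ⟶ Q.V), x ≫ q.f = inj j := by
    intro j
    obtain ⟨Q, q, hQ, -, hfac, -⟩ := cov PUnit (by simpa using one_lt_aleph0.trans hunc)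
      (fun _ => τ j) (fun _ => inj j)
    obtain ⟨x, hx⟩ := hfac ⟨⟩
    exact ⟨Q, q, hQ, x, hx⟩
  choose P p hP x hx using single
  -- Directedness: two small coalgebras over `A` factor through one small split subcoalgebra, on
  -- which morphisms are tested by components of `A`.
  have join : ∀ (Q Q' : Coalgebra F), smallCoalgebra Cn k F Q → smallCoalgebra Cn k F Q' →
      ∀ (s : Q ⟶ A) (s' : Q' ⟶ A), ∃ (R : Coalgebra F) (_ : smallCoalgebra Cn k F R) (r : R ⟶ A)
        (u : Q ⟶ R) (u' : Q' ⟶ R), IsSplitMono r.f ∧ u ≫ r = s ∧ u' ≫ r = s' ∧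
          ∀ (Y : D) (h h' : R.V ⟶ Y), (∀ j (y : Cn (τ j) ⟶ R.V), y ≫ r.f = inj j →
            y ≫ h = y ≫ h') → h = h' := by
    rintro Q Q' ⟨I, σ, i, hI, ⟨hQ⟩⟩ ⟨I', σ', i', hI', ⟨hQ'⟩⟩ s s'
    obtain ⟨R, r, hR, hmono, hfac, hgen⟩ := cov (I ⊕ I')
      (by simpa using add_lt_of_lt hk.aleph0_le hI hI') (Sum.elim σ σ')
      (Sum.rec (fun a => i a ≫ s.f) (fun a => i' a ≫ s'.f))
    obtain ⟨u, hu⟩ := exists_factor_of_isSplitMono r hQ s fun a => hfac (Sum.inl a)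
    obtain ⟨u', hu'⟩ := exists_factor_of_isSplitMono r hQ' s' fun a => hfac (Sum.inr a)
    exact ⟨R, hR, r, u, u', hmono, hu, hu', hgen⟩
  -- The value prescribed on component `j` does not depend on the small coalgebra through which it
  -- is lifted, so `h` below is forced.
  have indep : ∀ Q hQ (s : Q ⟶ A) j (y : Cn (τ j) ⟶ Q.V), y ≫ s.f = inj j →
      y ≫ (c Q hQ).f = x j ≫ (c (P j) (hP j)).f := by
    intro Q hQ s j y hy
    obtain ⟨R, hR, r, u, u', hmono, hu, hu', -⟩ := join Q (P j) hQ (hP j) s (p j)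
    rw [← hc Q R hQ hR u, ← hc (P j) R (hP j) hR u', Coalgebra.comp_f, Coalgebra.comp_f,
      ← Category.assoc, ← Category.assoc]
    congr 1
    rw [← cancel_mono r.f, Category.assoc, Category.assoc, ← Coalgebra.comp_f,
      ← Coalgebra.comp_f, hu, hu', hy, hx]
  let h : A.V ⟶ Z.V := cofanDesc hA fun j => x j ≫ (c (P j) (hP j)).f
  have inj_h : ∀ j, inj j ≫ h = x j ≫ (c (P j) (hP j)).f :=
    fun j => inj_cofanDesc hA _ j
  have hs : ∀ Q hQ (s : Q ⟶ A), s.f ≫ h = (c Q hQ).f := by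
    intro Q hQ s
    obtain ⟨R, hR, r, u, -, -, hu, -, hgen⟩ := join Q Q hQ hQ s s
    have hr : r.f ≫ h = (c R hR).f := hgen _ _ _ fun j y hy => by
      rw [← Category.assoc, hy, inj_h, indep R hR r j y hy]
    rw [← hu, Coalgebra.comp_f, Category.assoc, hr, ← hc Q R hQ hR u, Coalgebra.comp_f]
  refine ⟨⟨h, cofan_hom_ext hA fun j => ?_⟩, fun Q hQ s => Coalgebra.ext (hs Q hQ s)⟩
  have hPj := hs (P j) (hP j) (p j)
  calc inj j ≫ A.str ≫ F.map h = x j ≫ (p j).f ≫ A.str ≫ F.map h := by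
        rw [← hx j, Category.assoc]
    _ = x j ≫ (P j).str ≫ F.map ((p j).f ≫ h) := by
        rw [F.map_comp, Coalgebra.Hom.h_assoc]
    _ = x j ≫ (c (P j) (hP j)).f ≫ Z.str := by rw [hPj, Coalgebra.Hom.h]
    _ = inj j ≫ h ≫ Z.str := by rw [← Category.assoc, ← inj_h, Category.assoc]

end Covering

/-! ### Colimits of coalgebras and the terminal coalgebra. -/

section Coalgebras

open Cardinal Endofunctor

variable {D : Type u} [Category.{v} D]

/-- The forgetful functor from coalgebras lifts colimits. -/
theorem hasColimit_coalgebra {J : Type v} [SmallCategory J] {F : D ⥤ D} (K : J ⥤ Coalgebra F)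
    [HasColimit (K ⋙ Coalgebra.forget F)] : HasColimit K := by
  obtain ⟨L, ι, w, hL⟩ : ∃ (L : D) (ι : ∀ j, (K.obj j).V ⟶ L),
      (∀ i j (f : i ⟶ j), (K.map f).f ≫ ι j = ι i) ∧
      ∀ (Z : D) (z : ∀ j, (K.obj j).V ⟶ Z), (∀ i j (f : i ⟶ j), (K.map f).f ≫ z j = z i) →
        ∃! d : L ⟶ Z, ∀ j, ι j ≫ d = z j := by
    refine ⟨colimit (K ⋙ Coalgebra.forget F), fun j => colimit.ι (K ⋙ Coalgebra.forget F) j,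
      fun i j f => colimit.w (K ⋙ Coalgebra.forget F) f, fun Z z hz => ?_⟩
    let s : Cocone (K ⋙ Coalgebra.forget F) :=
      { pt := Z
        ι :=
          { app := z
            naturality := fun i j f => (hz i j f).trans (Category.comp_id _).symm } }
    exact ⟨colimit.desc _ s, fun j => colimit.ι_desc s j,
      fun d hd => colimit.hom_ext fun j => (hd j).trans (colimit.ι_desc s j).symm⟩
  have ext : ∀ {Z : D} {f g : L ⟶ Z}, (∀ j, ι j ≫ f = ι j ≫ g) → f = g := by
    intro Z f g hfg
    refine (hL Z (fun j => ι j ≫ g) fun i j u => ?_).unique hfg fun _ => rfl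
    rw [← Category.assoc, w]
  obtain ⟨str, hstr, -⟩ := hL (F.obj L) (fun j => (K.obj j).str ≫ F.map (ι j)) fun i j f => by
    rw [← w i j f, F.map_comp, Coalgebra.Hom.h_assoc]
  let c : Cocone K :=
    { pt := ⟨L, str⟩
      ι :=
        { app := fun j => ⟨ι j, (hstr j).symm⟩
          naturality := fun i j f => Coalgebra.ext ((w i j f).trans (Category.comp_id _).symm) } }
  have hdesc : ∀ s : Cocone K, ∃ d : L ⟶ s.pt.V, ∀ j, ι j ≫ d = (s.ι.app j).f := fun s =>
    (hL s.pt.V (fun j => (s.ι.app j).f) fun i j f =>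
      congrArg Coalgebra.Hom.f (s.w f)).exists
  choose desc ι_desc using hdesc
  refine ⟨⟨⟨c, { desc := fun s => ⟨desc s, ?_⟩, fac := ?_, uniq := ?_ }⟩⟩⟩
  · refine ext fun j => ?_
    change ι j ≫ str ≫ _ = ι j ≫ _
    rw [← Category.assoc, hstr, Category.assoc, ← F.map_comp, ι_desc, ← Category.assoc, ι_desc,
      Coalgebra.Hom.h]
    rfl
  · exact fun s j => Coalgebra.ext (ι_desc s j)
  · refine fun s m hm => Coalgebra.ext (ext fun j => ?_)
    exact (congrArg Coalgebra.Hom.f (hm j)).trans (ι_desc s j).symm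

variable {T : Type v} {Cn : T → D} {k : Cardinal.{v}}

/-- Initial segments of `k.ord` serve as canonical index sets, so that the small coalgebras can be
counted. -/
theorem exists_equiv_Iio {J : Type v} (hJ : #J < k) :
    ∃ i : k.ord.ToType, Nonempty (Set.Iio i ≃ J) := by
  refine ⟨Ordinal.ToType.mk ⟨(#J).ord, ord_lt_ord.2 hJ⟩, ?_⟩
  rw [← Cardinal.eq]
  have h := Ordinal.card_typein (r := (· < · : k.ord.ToType → k.ord.ToType → Prop))
    (Ordinal.ToType.mk ⟨(#J).ord, ord_lt_ord.2 hJ⟩)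
  have h' := congrArg Subtype.val
    (Ordinal.ToType.mk.symm_apply_apply (⟨(#J).ord, ord_lt_ord.2 hJ⟩ : Set.Iio k.ord))
  change Ordinal.typein _ _ = _ at h'
  rw [h', card_ord] at h
  exact h.symm

/-- Up to isomorphism there are at most `k` small coalgebras. -/
theorem exists_small_coalgebra_family (gch : GCH.{v}) (hk : k.IsRegular)
    (hD : IsGeneratedBy Cn k) (F : D ⥤ D) :
    ∃ (Θ : Type v) (Q : Θ → Coalgebra F), #Θ ≤ k ∧ (∀ θ, smallCoalgebra Cn k F (Q θ)) ∧
      ∀ P, smallCoalgebra Cn k F P → ∃ θ, Nonempty (P ≅ Q θ) := by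
  have hcop : ∀ (i : k.ord.ToType) (f : Set.Iio i → T), HasCoproduct fun x => Cn (f x) :=
    fun i f => hD.hasCoproduct (mk_Iio_ord_toType_lt_self i).le _
  -- A small coalgebra is coded by its number of components, their types and its structure map; each
  -- is chosen in at most `k` ways because `k ^ c ≤ k` for `c < k`.
  refine ⟨Σ (i : k.ord.ToType) (f : Set.Iio i → T),
    (∐ fun x => Cn (f x)) ⟶ F.obj (∐ fun x => Cn (f x)), fun θ => ⟨_, θ.2.2⟩, ?_, ?_, ?_⟩
  · rw [mk_sigma]
    refine (sum_le_sum _ (fun _ => k) fun i => ?_).trans (by simp [mul_eq_self hk.aleph0_le])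
    have hi := power_le_self_of_lt gch hk (mk_Iio_ord_toType_lt_self i)
    rw [mk_sigma]
    refine (sum_le_sum _ (fun _ => k) fun f => ?_).trans ?_
    · have hinj : Function.Injective
          (fun (g : (∐ fun x => Cn (f x)) ⟶ F.obj (∐ fun x => Cn (f x))) x =>
            Sigma.ι (fun x => Cn (f x)) x ≫ g) :=
        fun g g' h => Sigma.hom_ext _ _ fun x => congrFun h x
      refine (mk_le_of_injective hinj).trans ?_
      rw [mk_pi]
      refine (prod_le_prod _ (fun _ => k) fun x => hD.card_hom_le _ _).trans ?_
      simpa using hi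
    · rw [sum_const]
      have : #(Set.Iio i → T) ≤ k := by
        have h : #(Set.Iio i → T) = #T ^ #(Set.Iio i) := by simp
        rw [h]
        exact (power_le_power_right hD.card_lt.le).trans hi
      simpa using (mul_le_mul' this le_rfl).trans (mul_eq_self hk.aleph0_le).le
  · rintro ⟨i, f, a⟩
    exact ⟨_, f, _, mk_Iio_ord_toType_lt_self i, ⟨coproductIsCoproduct _⟩⟩
  · rintro ⟨V, a⟩ ⟨J, τ, inj, hJ, ⟨hV⟩⟩
    obtain ⟨i, ⟨e⟩⟩ := exists_equiv_Iio hJ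
    let hV' : IsColimit (Cofan.mk V fun x => inj (e x)) := Cofan.isColimitEquivOfEquiv e _ hV
    let φ : V ≅ ∐ fun x => Cn (τ (e x)) :=
      hV'.coconePointUniqueUpToIso (coproductIsCoproduct fun x => Cn (τ (e x)))
    exact ⟨⟨i, fun x => τ (e x), φ.inv ≫ a ≫ F.map φ.hom⟩, ⟨Coalgebra.isoMk φ (by simp)⟩⟩

/-- In a category generated by a small family of objects every endofunctor has a terminal
coalgebra, namely the colimit of all small coalgebras. -/
theorem hasTerminal_coalgebra (gch : GCH.{v}) (hk : k.IsRegular) (hunc : ℵ₀ < k)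
    (hD : IsGeneratedBy Cn k) (F : D ⥤ D) : HasTerminal (Coalgebra F) := by
  obtain ⟨Θ, Q, hΘ, hQ, hrep⟩ := exists_small_coalgebra_family gch hk hD F
  choose θ e using hrep
  -- Only the objects of the diagram are counted, so the full subcategory on the representatives is
  -- admissible.
  have := hD.hasColimits (InducedCategory (Coalgebra F) Q) hΘ
  have := hasColimit_coalgebra (inducedFunctor Q)
  let L : Coalgebra F := colimit (inducedFunctor Q)
  let ι : ∀ x, Q x ⟶ L := fun x => colimit.ι (inducedFunctor Q) x
  have ι_w : ∀ {x y} (f : Q x ⟶ Q y), f ≫ ι y = ι x := fun {x y} f =>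
    colimit.w (inducedFunctor Q) (InducedCategory.homMk (X := x) (Y := y) f)
  let c : ∀ P, smallCoalgebra Cn k F P → (P ⟶ L) := fun P hP => (e P hP).some.hom ≫ ι (θ P hP)
  have hc : ∀ P P' hP hP' (u : P ⟶ P'), u ≫ c P' hP' = c P hP := by
    intro P P' hP hP' u
    have := ι_w ((e P hP).some.inv ≫ u ≫ (e P' hP').some.hom)
    simp only [c, ← this, Category.assoc, Iso.hom_inv_id_assoc]
  have ι_eq : ∀ x, c (Q x) (hQ x) = ι x := fun x => ι_w _
  have ext := exists_coalgebra_hom_of_small gch hk hunc hD c hc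
  -- Extending the family `c` to `L` itself gives an endomorphism of `L` fixing every `ι x`, hence
  -- the identity; so each small coalgebra has exactly one homomorphism to `L`.
  have uniq : ∀ P hP (s : P ⟶ L), s = c P hP := by
    obtain ⟨φ, hφ⟩ := ext L
    have : φ = 𝟙 L := colimit.hom_ext fun x => by
      rw [Category.comp_id]
      exact (hφ _ (hQ x) (ι x)).trans (ι_eq x)
    subst this
    intro P hP s
    simpa using hφ P hP s
  choose h hh using ext
  refine IsTerminal.hasTerminal (X := L) (IsTerminal.ofUniqueHom h fun A m => ?_)
  exact coalgebra_hom_ext_of_small gch hk hunc hD _ _ fun P hP s =>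
    (uniq P hP _).trans (uniq P hP _).symm

end Coalgebras

/-! ### Objects of power at most `k` are closed under colimits of size at most `k`. -/

section PowerBounds

open Cardinal

variable {C : Type u} [Category.{v} C]

theorem nonempty_isColimit_cofan {J : Type v} {Y : J → C} {X : C} {inj : ∀ j, Y j ⟶ X}
    (h : ∀ (Z : C) (z : ∀ j, Y j ⟶ Z), ∃! d : X ⟶ Z, ∀ j, inj j ≫ d = z j) :
    Nonempty (IsColimit (Cofan.mk X inj)) :=
  ⟨Cofan.IsColimit.mk _ (fun s => (h s.pt s.inj).choose)
    (fun s j => (h s.pt s.inj).choose_spec.1 j)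
    (fun s m hm => (h s.pt s.inj).choose_spec.2 m hm)⟩

/-- Fewer than `k` connected objects represent all connected objects up to isomorphism. -/
theorem exists_connected_representatives {w k : Cardinal.{v}} (hw : IsWidthBound C w)
    (hwk : w < k) : ∃ (T : Type v) (Cn : T → C), #T < k ∧ (∀ t, IsConnectedObject (Cn t)) ∧
      ∀ X, IsConnectedObject X → ∃ t, Nonempty (Cn t ≅ X) := by
  have h : lift.{v} #(connectedClasses C) ≤ lift.{u} #w.out := by simpa using hw.1
  obtain ⟨emb⟩ := lift_mk_le'.1 h
  let e := Equiv.ofInjective emb emb.injective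
  choose Cn hCn hcls using fun c : connectedClasses C => c.2
  refine ⟨Set.range emb, fun t => Cn (e.symm t), ?_, fun t => hCn _,
    fun X hX => ⟨e ⟨_, X, hX, rfl⟩, Quotient.exact ((hcls _).trans
      (congrArg Subtype.val (e.symm_apply_apply _)))⟩⟩
  exact (mk_subtype_le _).trans_lt (by simpa using hwk)

variable {T : Type v} {Cn : T → C} {k : Cardinal.{v}}

/-- A coproduct decomposition into connected objects can be rewritten in terms of
representatives of the connected objects. -/
theorem exists_typed_decomposition
    (hrep : ∀ X, IsConnectedObject X → ∃ t, Nonempty (Cn t ≅ X)) {X : C} {α : Cardinal.{v}}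
    (hX : HasPower X α) : ∃ (J : Type v) (τ : J → T) (inj : ∀ j, Cn (τ j) ⟶ X),
      #J = α ∧ Nonempty (IsColimit (Cofan.mk X inj)) := by
  obtain ⟨J, Y, inj, hJ, hY, ⟨hX⟩⟩ := hX
  choose τ e using fun j => hrep (Y j) (hY j)
  refine ⟨J, τ, fun j => (e j).some.hom ≫ inj j, hJ, nonempty_isColimit_cofan fun Z z =>
    ⟨cofanDesc hX fun j => (e j).some.inv ≫ z j, fun j => ?_, fun d hd => cofan_hom_ext hX
      fun j => ?_⟩⟩
  · rw [Category.assoc, inj_cofanDesc hX _ j, Iso.hom_inv_id_assoc]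
  · rw [inj_cofanDesc hX _ j, ← hd j, Category.assoc, Iso.inv_hom_id_assoc]

theorem powerLE_of_isColimit (hCn : ∀ t, IsConnectedObject (Cn t)) {J : Type v} (hJ : #J ≤ k)
    (τ : J → T) {X : C} {inj : ∀ j, Cn (τ j) ⟶ X} (hX : IsColimit (Cofan.mk X inj)) :
    powerLE C k X :=
  ⟨#J, hJ, J, fun j => Cn (τ j), inj, rfl, fun _ => hCn _, ⟨hX⟩⟩

theorem powerLE_of_isConnectedObject (hk : ℵ₀ ≤ k) {X : C} (hX : IsConnectedObject X) :
    powerLE C k X :=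
  ⟨1, one_le_aleph0.trans hk, PUnit, fun _ => X, fun _ => 𝟙 X, by simp, fun _ => hX,
    nonempty_isColimit_cofan fun _ z => ⟨z ⟨⟩, fun _ => Category.id_comp _, fun d hd => by
      rw [← hd ⟨⟩, Category.id_comp]⟩⟩

/-- A coproduct of at most `k` objects of power at most `k` has power at most `k`. -/
theorem powerLE_coproduct (hk : ℵ₀ ≤ k) {I : Type v} (hI : #I ≤ k) {X : I → C} {Z : C}
    {inj : ∀ i, X i ⟶ Z} (hZ : IsColimit (Cofan.mk Z inj)) (hX : ∀ i, powerLE C k (X i)) :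
    powerLE C k Z := by
  choose α hα J Y ι hJ hY hι using hX
  refine ⟨_, ?_, Σ i, J i, fun p => Y p.1 p.2, fun p => ι p.1 p.2 ≫ inj p.1, rfl,
    fun p => hY _ _, nonempty_isColimit_cofan fun W z =>
      ⟨cofanDesc hZ fun i => cofanDesc (hι i).some fun j => z ⟨i, j⟩, ?_, fun d hd =>
        cofan_hom_ext hZ fun i => cofan_hom_ext (hι i).some fun j => ?_⟩⟩
  · rw [mk_sigma]
    refine (sum_le_sum _ (fun _ => k) fun i => (hJ i).trans_le (hα i)).trans ?_
    simpa using (mul_le_mul' hI le_rfl).trans (mul_eq_self hk).le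
  · rintro ⟨i, j⟩
    change (ι i j ≫ inj i) ≫ _ = _
    rw [Category.assoc, inj_cofanDesc hZ, inj_cofanDesc (hι i).some (fun j => z ⟨i, j⟩) j]
  · rw [inj_cofanDesc hZ _ i, inj_cofanDesc (hι i).some (fun j => z ⟨i, j⟩) j, ← hd ⟨i, j⟩,
      Category.assoc]

/-- There are at most `k` morphisms from a connected object to one of power at most `k`. -/
theorem mk_hom_le_of_powerLE [HasColimits C] {w : Cardinal.{v}} (hw : IsWidthBound C w)
    (hk : ℵ₀ ≤ k) (hwk : w < k) {B X : C} (hB : IsConnectedObject B) (hX : powerLE C k X) :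
    #(B ⟶ X) ≤ k := by
  rcases isEmpty_or_nonempty (B ⟶ X) with hempty | ⟨⟨f⟩⟩
  · simp
  obtain ⟨α, hα, J, Y, inj, hJ, hY, ⟨hX⟩⟩ := hX
  -- The width bound speaks of power exactly `k`, so `X` is padded with `k` copies of `B`; the
  -- morphism `f` makes `X` a retract of the result.
  let Y' : J ⊕ k.out → C := Sum.elim Y fun _ => B
  have hpow : HasPower (∐ Y') k := by
    refine ⟨J ⊕ k.out, Y', Sigma.ι Y', ?_, ?_, ⟨coproductIsCoproduct Y'⟩⟩
    · rw [mk_sum, lift_id, lift_id, mk_out, hJ, add_eq_right hk hα]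
    · rintro (j | x)
      · exact hY j
      · exact hB
  let ι : ∀ j, Y j ⟶ ∐ Y' := fun j => Sigma.ι Y' (Sum.inl j)
  let m : X ⟶ ∐ Y' := cofanDesc hX ι
  let r : (∐ Y') ⟶ X := Sigma.desc (Sum.rec inj fun _ => f)
  have ι_r : ∀ j, ι j ≫ r = inj j := fun j => Sigma.ι_desc (f := Y') _ (Sum.inl j)
  have hmr : m ≫ r = 𝟙 X := cofan_hom_ext hX fun j => by
    rw [← Category.assoc, inj_cofanDesc hX ι j, ι_r, Category.comp_id]
  have : IsSplitMono m := ⟨⟨⟨r, hmr⟩⟩⟩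
  exact (mk_le_of_injective fun g g' h => (cancel_mono m).1 h).trans
    (hw.2 k hwk.le B _ hB hpow)

/-- If `Y` is a quotient of an object of power at most `k` and more than `k` components of `Y`
have type `t`, then there is at most one morphism from the connected object of type `t` to any
object of power at most `k` that receives a morphism from `Y`. -/
theorem hom_eq_of_many_components (gch : GCH.{v}) (hk : ℵ₀ ≤ k)
    (hhom : ∀ t X, powerLE C k X → #(Cn t ⟶ X) ≤ k) {X Y Z : C} (e : X ⟶ Y) [Epi e]
    {I : Type v} (hI : #I ≤ k) (σ : I → T) {injX : ∀ i, Cn (σ i) ⟶ X}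
    (hX : IsColimit (Cofan.mk X injX)) {J : Type v} (τ : J → T) {injY : ∀ j, Cn (τ j) ⟶ Y}
    (hY : IsColimit (Cofan.mk Y injY)) (hZ : powerLE C k Z) (m : Y ⟶ Z) {t : T}
    (ht : k < #{j // τ j = t}) (f f' : Cn t ⟶ Z) : f = f' := by
  classical
  by_contra hne
  -- Choosing `f` or `f'` independently on each component of type `t`, and `m` elsewhere, gives too
  -- many morphisms out of the quotient `Y` of `X`.
  let d : ({j // τ j = t} → Bool) → (Y ⟶ Z) := fun g => cofanDesc hY fun j =>
    if h : τ j = t then eqToHom (congrArg Cn h) ≫ bif g ⟨j, h⟩ then f else f' else injY j ≫ m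
  have hd : Function.Injective fun g i => injX i ≫ e ≫ d g := by
    intro g g' h
    have hdd : d g = d g' := (cancel_epi e).1 (cofan_hom_ext hX fun i => congrFun h i)
    funext ⟨j, hj⟩
    have h' := congrArg (injY j ≫ ·) hdd
    simp only [d, inj_cofanDesc hY _ j, dif_pos hj] at h'
    have h'' := (cancel_epi (eqToHom (congrArg Cn hj))).1 h'
    rcases hg : g ⟨j, hj⟩ <;> rcases hg' : g' ⟨j, hj⟩ <;> simp [hg, hg'] at h'' ⊢
    · exact hne h''.symm
    · exact hne h''
  have h1 : (2 : Cardinal.{v}) ^ #{j // τ j = t} ≤ k ^ k := by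
    have := mk_le_of_injective hd
    rw [mk_pi fun i => Cn (σ i) ⟶ Z] at this
    have h2 : #({j // τ j = t} → Bool) = 2 ^ #{j // τ j = t} := by simp
    rw [← h2]
    refine this.trans ((prod_le_prod _ (fun _ => k) fun i => hhom _ _ hZ).trans ?_)
    simpa using power_le_power_left (aleph0_pos.trans_le hk).ne' hI
  -- Now `2 ^ μ ≤ succ k ≤ μ` for `μ` the number of components of type `t`, against Cantor.
  rw [power_self_eq hk, ← gch k hk] at h1
  exact ((cantor _).trans_le (h1.trans (Order.succ_le_of_lt ht))).false

/-- Quotients of objects of power at most `k` have power at most `k`. -/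
theorem powerLE_of_epi [HasColimits C] (gch : GCH.{v}) (hk : ℵ₀ ≤ k) (hT : #T < k)
    (hCn : ∀ t, IsConnectedObject (Cn t))
    (hrep : ∀ X, IsConnectedObject X → ∃ t, Nonempty (Cn t ≅ X))
    (hhom : ∀ t X, powerLE C k X → #(Cn t ⟶ X) ≤ k) {X Y : C} (e : X ⟶ Y) [Epi e]
    (hX : powerLE C k X) {α : Cardinal.{v}} (hY : HasPower Y α) : powerLE C k Y := by
  obtain ⟨β, hβ, hX⟩ := hX
  obtain ⟨I, σ, injX, hI, ⟨hX⟩⟩ := exists_typed_decomposition hrep hX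
  obtain ⟨J, τ, inj, -, ⟨hY⟩⟩ := exists_typed_decomposition hrep hY
  obtain ⟨R₁, hR₁, hR₁rep⟩ := exists_small_representatives hT τ
  -- All components of types occurring at most `k` times, and one component of each type. The others
  -- are redundant: their injections coincide with that of the representative.
  let R : Set J := {j | #{i // τ i = τ j} ≤ k} ∪ R₁
  have hR : #R ≤ k := by
    refine (mk_union_le _ _).trans (add_le_of_le hk ?_ hR₁.le)
    have hsub : {j | #{i // τ i = τ j} ≤ k} ⊆
        ⋃ t : {t // #{i // τ i = t} ≤ k}, {j | τ j = t.1} :=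
      fun j hj => Set.mem_iUnion.2 ⟨⟨τ j, hj⟩, rfl⟩
    refine (mk_le_mk_of_subset hsub).trans ((mk_iUnion_le_sum_mk).trans ?_)
    refine (sum_le_sum _ (fun _ => k) fun t => t.2).trans ?_
    simpa using (mul_le_mul' ((mk_subtype_le _).trans hT.le) le_rfl).trans (mul_eq_self hk).le
  have key : ∀ j, ∃ (i : R) (h : τ j = τ i), inj j = eqToHom (congrArg Cn h) ≫ inj i := by
    intro j
    by_cases hj : j ∈ R
    · exact ⟨⟨j, hj⟩, rfl, by simp⟩
    obtain ⟨i, hi⟩ := hR₁rep j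
    refine ⟨⟨i, Or.inr i.2⟩, hi.symm, ?_⟩
    have hmany : k < #{i // τ i = τ j} := not_le.1 fun h => hj (Or.inl h)
    -- Both injections to be compared factor through the coproduct `V` over `R'`, which has power at
    -- most `k` and receives a morphism from `Y`; they already agree in `V`.
    let R' : Set J := insert j R
    have hR' : #R' ≤ k := mk_insert_le.trans (add_le_of_le hk hR (one_le_aleph0.trans hk))
    let V : C := ∐ fun x : R' => Cn (τ x)
    let ι : ∀ x : R', Cn (τ x) ⟶ V := Sigma.ι fun x : R' => Cn (τ x)
    have hV : powerLE C k V := powerLE_of_isColimit hCn hR' (fun x : R' => τ x)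
      (coproductIsCoproduct fun x : R' => Cn (τ x))
    obtain ⟨m, -⟩ := exists_retraction_of_subcoproduct inj hY R' ι fun x => by
      obtain ⟨y, hy⟩ := hR₁rep x
      exact ⟨⟨y, Or.inr (Or.inr y.2)⟩, ⟨eqToHom (congrArg Cn hy.symm)⟩⟩
    have heq := hom_eq_of_many_components gch hk hhom e (hI.trans_le hβ) σ hX τ hY hV m hmany
      (ι ⟨j, Or.inl rfl⟩) (eqToHom (congrArg Cn hi.symm) ≫ ι ⟨i, Or.inr (Or.inr i.2)⟩)
    have h := congrArg (· ≫ Sigma.desc fun x : R' => inj x) heq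
    have ι_desc : ∀ x, ι x ≫ (Sigma.desc fun x : R' => inj x) = inj x :=
      fun x => Sigma.ι_desc _ _
    simpa only [Category.assoc, ι_desc] using h
  refine ⟨_, hR, R, fun j => Cn (τ j), fun j => inj j, rfl, fun _ => hCn _,
    nonempty_isColimit_cofan fun Z z => ?_⟩
  obtain ⟨r, hr⟩ := exists_retraction_of_subcoproduct inj hY R z fun j => by
    obtain ⟨i, hi, -⟩ := key j
    exact ⟨i, ⟨eqToHom (congrArg Cn hi)⟩⟩
  refine ⟨r, hr, fun d hd => cofan_hom_ext hY fun j => ?_⟩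
  obtain ⟨i, hi, hij⟩ := key j
  rw [hij, Category.assoc, Category.assoc, hd, hr]

/-- A colimit is a quotient of the coproduct of the objects of its diagram, so the number of arrows
plays no role. -/
theorem isClosedUnderColimitsOfShape_powerLE [HasColimits C] (gch : GCH.{v}) (hk : ℵ₀ ≤ k)
    (hT : #T < k) (hCn : ∀ t, IsConnectedObject (Cn t))
    (hrep : ∀ X, IsConnectedObject X → ∃ t, Nonempty (Cn t ≅ X))
    (hhom : ∀ t X, powerLE C k X → #(Cn t ⟶ X) ≤ k)
    (hpow : ∀ X : C, ∃ α : Cardinal.{v}, HasPower X α) (J : Type v) [SmallCategory J]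
    (hJ : #J ≤ k) : (powerLE C k).IsClosedUnderColimitsOfShape J := by
  refine ⟨?_⟩
  rintro X ⟨P⟩
  obtain ⟨α, hα⟩ := hpow X
  let q : (∐ P.diag.obj) ⟶ X := Sigma.desc P.ι.app
  have hq : ∀ j, Sigma.ι P.diag.obj j ≫ q = P.ι.app j := fun j => Sigma.ι_desc _ _
  have : Epi q := ⟨fun g h hgh => P.isColimit.hom_ext fun j => by
    change P.ι.app j ≫ g = P.ι.app j ≫ h
    rw [← hq, Category.assoc, Category.assoc, hgh]⟩
  exact powerLE_of_epi gch hk hT hCn hrep hhom q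
    (powerLE_coproduct hk hJ (coproductIsCoproduct P.diag.obj) P.prop_diag_obj) hα

/-- For a category of width less than `k`, the objects of power at most `k` form a category
generated by fewer than `k` connected objects. -/
theorem isGeneratedBy_powerLE [HasColimits C] (gch : GCH.{v}) {w : Cardinal.{v}}
    (hw : HasWidth C w) (hk : ℵ₀ ≤ k) (hwk : w < k) :
    ∃ (T : Type v) (Cn : T → (powerLE C k).FullSubcategory), IsGeneratedBy Cn k := by
  obtain ⟨-, hpow, hbound, -⟩ := hw
  obtain ⟨T, Cn, hT, hCn, hrep⟩ := exists_connected_representatives hbound hwk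
  have hhom : ∀ t X, powerLE C k X → #(Cn t ⟶ X) ≤ k :=
    fun t X => mk_hom_le_of_powerLE hbound hk hwk (hCn t)
  refine ⟨T, fun t => ⟨Cn t, powerLE_of_isConnectedObject hk (hCn t)⟩, hT, ?_, ?_, ?_⟩
  · rintro ⟨X, α, hα, hX⟩
    obtain ⟨J, τ, inj, hJ, ⟨hX⟩⟩ := exists_typed_decomposition hrep hX
    refine ⟨J, τ, fun j => ObjectProperty.homMk (inj j), hJ.trans_le hα,
      nonempty_isColimit_cofan fun Z z =>
        ⟨ObjectProperty.homMk (cofanDesc hX fun j => (z j).hom), fun j => ?_, fun d hd => ?_⟩⟩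
    · exact ObjectProperty.hom_ext _ (inj_cofanDesc hX _ j)
    · refine ObjectProperty.hom_ext _ (cofan_hom_ext hX fun j => ?_)
      exact (congrArg (fun f => f.hom) (hd j)).trans
        (inj_cofanDesc hX (fun j => (z j).hom) j).symm
  · intro t X
    exact (mk_le_of_injective fun f g h => ObjectProperty.hom_ext _ h :
      #(_ ⟶ X) ≤ #(Cn t ⟶ X.obj)).trans (hhom t _ X.property)
  · intro J _ hJ
    have := isClosedUnderColimitsOfShape_powerLE gch hk hT hCn hrep hhom hpow J hJ
    infer_instance

end PowerBounds

end AlgebraicCocompleteness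

theorem theoremT (gch : GCH.{v}) (C : Type u) [Category.{v} C] [HasColimits C]
    (hC : IsCowellPowered C) (w : Cardinal.{v}) (hw : HasWidth C w)
    (k : Cardinal.{v}) (hk : k.IsRegular) (hk_unc : Cardinal.aleph0 < k) (hwk : w < k) :
    AlgebraicallyCocomplete (powerLE C k).FullSubcategory := by
  obtain ⟨T, Cn, hD⟩ := AlgebraicCocompleteness.isGeneratedBy_powerLE gch hw hk.aleph0_le hwk
  exact AlgebraicCocompleteness.hasTerminal_coalgebra gch hk hk_unc hD
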